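/- Let $\psi=\Gamma'/\Gamma$ be the digamma function, $\zeta$ the Riemann zeta function, and let the Stieltjes constants $\gamma_n$ be defined by the Laurent expansion $$\zeta(s)=\frac1{s-1}+\sum_{n=0}^{\infty}\frac{(-1)^n}{n!}\gamma_n(s-1)^n .$$ Let $Y_k(x_1,\dots,x_k)$ denote the (exponential) complete Bell polynomials, i.e. $Y_0=1$ and, for $k\ge1$, $$Y_k(x_1,\dots,x_k)=\sum \frac{k!}{m_1!\,m_2!\cdots m_k!}\left(\frac{x_1}{1!}\right)^{m_1}\left(\frac{x_2}{2!}\right)^{m_2}\cdots\left(\frac{x_k}{k!}\right)^{m_k},$$ where the sum is over all non-negative integers $m_1,\dots,m_k$ with $m_1+2m_2+\cdots+k\,m_k=k$. Then for every integer $n\ge0$ the function $u\mapsto\left[\psi'(1+u)-\frac1{1+u}\right]\log^n u$ is integrable on $(0,\infty)$ and $$\int_0^\infty\left[\psi'(1+u)-\frac1{1+u}\right]\log^n u\,du=\sum_{k=0}^n\binom nk(-1)^k\,\mathbf Y_k\,\gamma_{n-k},$$ where $\mathbf Y_k=Y_k(x_1,\dots,x_k)$ with $x_1=0$ and $x_j=[1+(-1)^j]\,(j-1)!\,\zeta(j)$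 for $2\le j\le k$; thus $\mathbf Y_k=Y_k\bigl(0,\,2\cdot1!\,\zeta(2),\,\dots,\,[1+(-1)^k](k-1)!\,\zeta(k)\bigr)$. -/

import Mathlib

open scoped Nat Topology

/-- The exponential complete Bell polynomial `Y_n(x_1, …, x_n)`:
the sum over all partitions of `n`, with `k_j` the number of parts equal to `j`, of
`n! / (k_1! ⋯ k_n!) * (x_1 / 1!) ^ k_1 ⋯ (x_n / n!) ^ k_n`. Only `x 1, …, x n` are used. -/
def completeBell {K : Type*} [Field K] (n : ℕ) (x : ℕ → K) : K :=
  ∑ p : n.Partition,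
    (n ! : K) / (∏ j ∈ Finset.Icc 1 n, ((p.parts.count j)! : K)) *
      ∏ j ∈ Finset.Icc 1 n, (x j / (j ! : K)) ^ p.parts.count j

/-- The regular part `ζ(s) - 1 / (s - 1)` of the Riemann zeta function at its pole `s = 1`,
with the removable singularity filled in by the limit `γ`. -/
noncomputable def zetaRegularPart : ℂ → ℂ :=
  Function.update (fun s : ℂ => riemannZeta s - 1 / (s - 1)) 1 (Real.eulerMascheroniConstant : ℂ)

/-- The Stieltjes constants, defined by the Laurent expansion
`ζ(s) = 1 / (s - 1) + ∑ n, (-1) ^ n / n! * γ_n * (s - 1) ^ n`; see `hasSum_stieltjesConstant`. -/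
noncomputable def stieltjesConstant (n : ℕ) : ℂ :=
  (-1) ^ n * iteratedDeriv n zetaRegularPart 1

theorem differentiable_zetaRegularPart : Differentiable ℂ zetaRegularPart := by
  have h : DifferentiableOn ℂ (fun s : ℂ => riemannZeta s - 1 / (s - 1)) ({1}ᶜ : Set ℂ) := by
    intro s hs
    have hs' : s - 1 ≠ 0 := sub_ne_zero.2 hs
    exact ((differentiableAt_riemannZeta hs).sub
      (by fun_prop (disch := exact hs'))).differentiableWithinAt
  have h2 : DifferentiableOn ℂ zetaRegularPart Set.univ := by
    refine (Complex.differentiableOn_compl_singleton_and_continuousAt_iff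
      (c := (1 : ℂ)) Filter.univ_mem).1 ⟨?_, ?_⟩
    · refine (h.mono (by intro s hs; exact hs.2)).congr ?_
      intro s hs
      exact Function.update_of_ne hs.2 _ _
    · exact continuousAt_update_same.2 tendsto_riemannZeta_sub_one_div
  exact differentiableOn_univ.1 h2

/-- The constants are the coefficients of the Laurent expansion of `ζ` about `1`. -/
theorem hasSum_stieltjesConstant {s : ℂ} (hs : s ≠ 1) :
    HasSum (fun n : ℕ => (-1) ^ n / (n ! : ℂ) * stieltjesConstant n * (s - 1) ^ n)
      (riemannZeta s - 1 / (s - 1)) := by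
  have h := Complex.hasSum_taylorSeries_of_entire differentiable_zetaRegularPart 1 s
  have e : zetaRegularPart s = riemannZeta s - 1 / (s - 1) := Function.update_of_ne hs _ _
  rw [e] at h
  refine (congrArg (fun f => HasSum f _) (funext fun n => ?_)).mp h
  have h1 : ((-1 : ℂ) ^ n) * (-1) ^ n = 1 := by rw [← mul_pow]; simp
  simp only [stieltjesConstant, smul_eq_mul]
  linear_combination -((n ! : ℂ)⁻¹ * iteratedDeriv n zetaRegularPart 1 * (s - 1) ^ n) * h1

/-! Write f(u) = ψ'(1+u) - 1/(1+u), and Z for the regular part of ζ at 1. The integrals are the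
derivatives at w = 1 of the Mellin transform of f, since each d/dw brings down a factor log u. That
transform is Γ(w)Γ(2-w)Z(2-w) on 0 < Re w < 2 (`mellin_trigammaRemainder`). For Re w < 1 this
follows from ψ'(1+u) = ∑ 1/(u+m+1)², integrated termwise into ζ(2-w)B(w,2-w), and from B(w,1-w) for
the subtracted term. The bound |f(u)| ≤ (1+u)⁻² makes the transform holomorphic on the larger strip,
and the identity theorem carries the formula to w = 1.

With w = 1+s, Leibniz splits the n-th derivative of Γ(1+s)Γ(1-s) · Z(1-s) at 0. The second factor
yields the Stieltjes constants. The first is πs/sin(πs), with logarithmic derivative 1/s - π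
cot(πs), whose Taylor coefficients are even zeta values (`hasSum_zeta_mul_pow`). The equation S' =
LS turns them into complete Bell polynomials (`iteratedDeriv_eq_completeBell`). -/

/-! ### Complete Bell polynomials and the equation S' = LS. -/

/-- The weight `∏ j, a j ^ c j / (c j)!` of a multiset, with `c j` the multiplicity of `j`. -/
def multisetExpWeight {K : Type*} [Field K] (a : ℕ → K) (m : Multiset ℕ) : K :=
  ∏ j ∈ m.toFinset, a j ^ m.count j / ((m.count j)! : K)

theorem multisetExpWeight_eq_prod {K : Type*} [Field K] (a : ℕ → K) (m : Multiset ℕ)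
    {s : Finset ℕ} (hs : m.toFinset ⊆ s) :
    multisetExpWeight a m = ∏ j ∈ s, a j ^ m.count j / ((m.count j)! : K) := by
  refine Finset.prod_subset hs fun j _ hj => ?_
  have : m.count j = 0 := Multiset.count_eq_zero.2 (by simpa using hj)
  simp [this]

theorem multisetExpWeight_cons {K : Type*} [Field K] [CharZero K] (a : ℕ → K) (j : ℕ)
    (m : Multiset ℕ) :
    ((j ::ₘ m).count j : K) * multisetExpWeight a (j ::ₘ m) = a j * multisetExpWeight a m := by
  classical
  rw [multisetExpWeight_eq_prod a (j ::ₘ m) (s := insert j m.toFinset) (by simp),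
    multisetExpWeight_eq_prod a m (s := insert j m.toFinset) (Finset.subset_insert _ _),
    ← Finset.mul_prod_erase _ _ (Finset.mem_insert_self j _),
    ← Finset.mul_prod_erase _ _ (Finset.mem_insert_self j _)]
  have h : ∀ i ∈ (insert j m.toFinset).erase j, a i ^ (j ::ₘ m).count i / (((j ::ₘ m).count i)! : K)
      = a i ^ m.count i / ((m.count i)! : K) := by
    intro i hi
    rw [Multiset.count_cons_of_ne (Finset.ne_of_mem_erase hi)]
  rw [Finset.prod_congr rfl h, Multiset.count_cons_self, Nat.factorial_succ, pow_succ]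
  have h1 : ((m.count j : K) + 1) ≠ 0 := by exact_mod_cast Nat.succ_ne_zero (m.count j)
  have h2 : ((m.count j)! : K) ≠ 0 := by exact_mod_cast Nat.factorial_ne_zero _
  push_cast
  field_simp

theorem completeBell_eq_sum_weight {K : Type*} [Field K] (n : ℕ) (x : ℕ → K) :
    completeBell n x =
      (n ! : K) * ∑ p : n.Partition, multisetExpWeight (fun j => x j / (j ! : K)) p.parts := by
  rw [completeBell, Finset.mul_sum]
  refine Finset.sum_congr rfl fun p _ => ?_
  have hs : p.parts.toFinset ⊆ Finset.Icc 1 n := by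
    intro j hj
    have hj' := Multiset.mem_toFinset.1 hj
    exact Finset.mem_Icc.2 ⟨p.parts_pos hj', p.le_of_mem_parts hj'⟩
  rw [multisetExpWeight_eq_prod _ _ hs, Finset.prod_div_distrib]
  ring

/-- Adding a part to a partition. -/
def Nat.Partition.consPart {n : ℕ} (q : n.Partition) (j : ℕ) (hj : 0 < j) {N : ℕ}
    (hN : j + n = N) : N.Partition where
  parts := j ::ₘ q.parts
  parts_pos := by
    intro i hi
    rcases Multiset.mem_cons.1 hi with rfl | hi
    · exact hj
    · exact q.parts_pos hi
  parts_sum := by rw [Multiset.sum_cons, q.parts_sum, hN]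

/-- Inserting a part j is a bijection from partitions of n onto those partitions of N that contain
j; the others are killed by the factor `count j`. -/
theorem sum_count_mul_multisetExpWeight {K : Type*} [Field K] [CharZero K] (a : ℕ → K)
    {n j N : ℕ} (hj : 0 < j) (hN : j + n = N) :
    ∑ p : N.Partition, (p.parts.count j : K) * multisetExpWeight a p.parts =
      a j * ∑ q : n.Partition, multisetExpWeight a q.parts := by
  rw [Finset.mul_sum]
  symm
  refine Finset.sum_of_injOn (fun q : n.Partition => q.consPart j hj hN) ?_ ?_ ?_ ?_
  · intro p _ q _ h
    have := congrArg Nat.Partition.parts h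
    exact Nat.Partition.ext ((Multiset.cons_inj_right j).1 this)
  · intro p _
    simp
  · intro p _ hp
    have : p.parts.count j = 0 := by
      rw [Multiset.count_eq_zero]
      intro hjp
      refine hp ⟨⟨p.parts.erase j, fun hi => p.parts_pos (Multiset.mem_of_mem_erase hi), ?_⟩,
        by simp, ?_⟩
      · have := Multiset.sum_erase hjp
        rw [p.parts_sum] at this
        omega
      · exact Nat.Partition.ext (Multiset.cons_erase hjp)
    simp [this]
  · intro q _
    exact (multisetExpWeight_cons a j q.parts).symm

theorem Nat.Partition.sum_mul_count {N : ℕ} (p : N.Partition) :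
    ∑ j ∈ Finset.Icc 1 N, j * p.parts.count j = N := by
  have hs : p.parts.toFinset ⊆ Finset.Icc 1 N := by
    intro j hj
    have hj' := Multiset.mem_toFinset.1 hj
    exact Finset.mem_Icc.2 ⟨p.parts_pos hj', p.le_of_mem_parts hj'⟩
  have := Finset.sum_multiset_count_of_subset p.parts (Finset.Icc 1 N) hs
  rw [p.parts_sum] at this
  simpa [mul_comm] using this.symm

theorem completeBell_zero {K : Type*} [Field K] (x : ℕ → K) : completeBell 0 x = 1 := by
  simp [completeBell]

/-- The recurrence `Y_{n+1} = ∑ i, C(n, i) Y_{n-i} x_{i+1}` of the complete Bell polynomials. -/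
theorem completeBell_succ {K : Type*} [Field K] [CharZero K] (n : ℕ) (x : ℕ → K) :
    completeBell (n + 1) x = ∑ i ∈ Finset.range (n + 1),
      (n.choose i : K) * x (i + 1) * completeBell (n - i) x := by
  simp only [completeBell_eq_sum_weight]
  set a : ℕ → K := fun j => x j / (j ! : K) with ha
  set y : ℕ → K := fun n => ∑ p : n.Partition, multisetExpWeight a p.parts with hy
  -- Weight each partition by its size written as ∑ j · count j, then exchange the sums: the
  -- recurrence without its factorials.
  have key : ((n + 1 : ℕ) : K) * y (n + 1) =
      ∑ i ∈ Finset.range (n + 1), ((i + 1 : ℕ) : K) * (a (i + 1) * y (n - i)) := by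
    calc ((n + 1 : ℕ) : K) * y (n + 1)
        = ∑ p : (n + 1).Partition, ∑ j ∈ Finset.Icc 1 (n + 1),
            (j : K) * ((p.parts.count j : K) * multisetExpWeight a p.parts) := by
          rw [hy, Finset.mul_sum]
          refine Finset.sum_congr rfl fun p _ => ?_
          have h := congrArg (Nat.cast : ℕ → K) p.sum_mul_count
          rw [← h, Nat.cast_sum, Finset.sum_mul]
          exact Finset.sum_congr rfl fun j _ => by push_cast; ring
      _ = ∑ j ∈ Finset.Icc 1 (n + 1), (j : K) * (a j * y (n + 1 - j)) := by
          rw [Finset.sum_comm]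
          refine Finset.sum_congr rfl fun j hj => ?_
          rw [Finset.mem_Icc] at hj
          rw [← Finset.mul_sum, sum_count_mul_multisetExpWeight a (n := n + 1 - j) hj.1 (by omega)]
      _ = _ := by
          have h := Finset.sum_Ico_add' (fun j : ℕ => (j : K) * (a j * y (n + 1 - j))) 0 (n + 1) 1
          rw [Finset.range_eq_Ico]
          refine Eq.trans ?_ (h.symm.trans (Finset.sum_congr rfl fun i _ => ?_))
          · rfl
          · simp only [Nat.add_sub_add_right]
  rw [Nat.factorial_succ, Nat.cast_mul, mul_comm ((n + 1 : ℕ) : K), mul_assoc, key, Finset.mul_sum]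
  refine Finset.sum_congr rfl fun i hi => ?_
  have hi' : i ≤ n := by simpa [Nat.lt_succ_iff] using hi
  rw [← Nat.choose_mul_factorial_mul_factorial hi']
  change _ = _ * _ * (_ * y (n - i))
  have h1 : ((i : K) + 1) ≠ 0 := by exact_mod_cast Nat.succ_ne_zero i
  have h2 : (i ! : K) ≠ 0 := by exact_mod_cast Nat.factorial_ne_zero _
  simp only [ha, Nat.factorial_succ]
  push_cast
  field_simp

/-- Leibniz applied to S' = LS is exactly the recurrence `completeBell_succ`. -/
theorem iteratedDeriv_eq_completeBell {S L : ℂ → ℂ} {x : ℕ → ℂ} {z : ℂ}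
    (hS : AnalyticAt ℂ S z) (hL : AnalyticAt ℂ L z)
    (hSL : deriv S =ᶠ[𝓝 z] fun w => L w * S w) (h1 : S z = 1)
    (hx : ∀ i, iteratedDeriv i L z = x (i + 1)) (n : ℕ) :
    iteratedDeriv n S z = completeBell n x := by
  induction n using Nat.strong_induction_on with
  | _ n ih =>
    cases n with
    | zero => simp [completeBell_zero, h1]
    | succ n =>
      rw [iteratedDeriv_succ', hSL.iteratedDeriv_eq n, completeBell_succ,
        iteratedDeriv_fun_mul hL.contDiffAt hS.contDiffAt]
      refine Finset.sum_congr rfl fun i _ => ?_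
      rw [hx, ih (n - i) (by omega)]

/-! ### The trigamma series, from log-convexity of Γ. -/

namespace Real

theorem differentiableAt_log_Gamma {x : ℝ} (hx : 0 < x) :
    DifferentiableAt ℝ (log ∘ Gamma) x := by
  refine (differentiableAt_Gamma ?_).log (Gamma_ne_zero ?_) <;>
  exact fun m ↦ ne_of_gt (by have : (0 : ℝ) ≤ m := m.cast_nonneg; linarith)

theorem deriv_log_Gamma_add_one {x : ℝ} (hx : 0 < x) :
    deriv (log ∘ Gamma) (x + 1) = deriv (log ∘ Gamma) x + 1 / x := by
  rw [← deriv_comp_add_const, one_div, ← deriv_log,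
    ← deriv_add (differentiableAt_log_Gamma hx) (differentiableAt_log hx.ne')]
  apply Filter.EventuallyEq.deriv_eq
  filter_upwards [eventually_gt_nhds hx] with y hy
  simp only [Function.comp_apply, Pi.add_apply, Gamma_add_one hy.ne',
    log_mul hy.ne' (Gamma_pos_of_pos hy).ne', add_comm]

theorem deriv_log_Gamma_add_nat {x : ℝ} (hx : 0 < x) (N : ℕ) :
    deriv (log ∘ Gamma) (x + N) =
      deriv (log ∘ Gamma) x + ∑ m ∈ Finset.range N, 1 / (x + m) := by
  induction N with
  | zero => simp
  | succ N ih =>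
    rw [Finset.sum_range_succ, ← add_assoc, ← ih, Nat.cast_succ, ← add_assoc,
      deriv_log_Gamma_add_one (by positivity)]

theorem monotoneOn_deriv_log_Gamma : MonotoneOn (deriv (log ∘ Gamma)) (Set.Ioi 0) :=
  convexOn_log_Gamma.monotoneOn_deriv fun _ hx => differentiableAt_log_Gamma hx

/-- Monotonicity traps the difference between 0 and the increment over k ≥ x - 1 unit steps, a sum
of k reciprocals tending to 0. -/
theorem tendsto_deriv_log_Gamma_sub {x : ℝ} (hx : 1 ≤ x) :
    Filter.Tendsto (fun N : ℕ => deriv (log ∘ Gamma) (x + N) - deriv (log ∘ Gamma) (1 + N))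
      Filter.atTop (𝓝 0) := by
  obtain ⟨k, hk⟩ := exists_nat_ge (x - 1)
  have hlim : Filter.Tendsto (fun N : ℕ => ∑ i ∈ Finset.range k, 1 / ((1 + N : ℝ) + i))
      Filter.atTop (𝓝 0) := by
    rw [← Finset.sum_const_zero (s := Finset.range k)]
    refine tendsto_finsetSum _ fun i _ => ?_
    refine Filter.Tendsto.const_div_atTop ?_ 1
    refine Filter.tendsto_atTop_add_const_right _ _ ?_
    exact Filter.tendsto_atTop_add_const_left _ _ tendsto_natCast_atTop_atTop
  refine squeeze_zero (fun N => ?_) (fun N => ?_) hlim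
  · refine sub_nonneg.2 (monotoneOn_deriv_log_Gamma ?_ ?_ (by linarith)) <;>
    · simp only [Set.mem_Ioi]
      positivity
  · have h := deriv_log_Gamma_add_nat (x := 1 + N) (by positivity) k
    rw [sub_le_iff_le_add', ← h]
    refine monotoneOn_deriv_log_Gamma ?_ ?_ ?_
    · simp; positivity
    · simp; positivity
    · linarith

theorem summable_one_div_nat_add_one_sq : Summable fun m : ℕ => 1 / ((m : ℝ) + 1) ^ 2 := by
  have h := (summable_nat_add_iff 1).2 (Real.summable_one_div_nat_pow.2 one_lt_two)
  simpa using h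

theorem summable_one_div_sub_one_div {x : ℝ} (hx : 1 ≤ x) :
    Summable fun m : ℕ => 1 / (1 + m : ℝ) - 1 / (x + m) := by
  refine Summable.of_nonneg_of_le (fun m => ?_) (fun m => ?_)
    (summable_one_div_nat_add_one_sq.mul_left (x - 1))
  · rw [sub_nonneg]
    gcongr
  · rw [div_sub_div _ _ (by positivity) (by positivity), mul_one_div]
    have hm : (0 : ℝ) ≤ m := m.cast_nonneg
    have : (m + 1 : ℝ) ^ 2 ≤ (1 + m) * (x + m) := by nlinarith
    have h1 : 1 * (x + m) - (1 + m) * 1 = x - 1 := by ring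
    rw [h1]
    exact div_le_div_of_nonneg_left (by linarith) (by positivity) this

theorem deriv_log_Gamma_eq_tsum {x : ℝ} (hx : 1 ≤ x) :
    deriv (log ∘ Gamma) x =
      deriv (log ∘ Gamma) 1 + ∑' m : ℕ, (1 / (1 + m : ℝ) - 1 / (x + m)) := by
  have h1 := (summable_one_div_sub_one_div hx).hasSum.tendsto_sum_nat
  have h2 := (tendsto_deriv_log_Gamma_sub hx).add h1
  -- The functional equation makes this expression independent of N, so its limit is its value.
  have h3 : ∀ N : ℕ, deriv (log ∘ Gamma) (x + N) - deriv (log ∘ Gamma) (1 + N) +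
      ∑ m ∈ Finset.range N, (1 / (1 + m : ℝ) - 1 / (x + m)) =
      deriv (log ∘ Gamma) x - deriv (log ∘ Gamma) 1 := by
    intro N
    rw [deriv_log_Gamma_add_nat (by linarith), deriv_log_Gamma_add_nat one_pos,
      Finset.sum_sub_distrib]
    ring
  simp only [h3] at h2
  linarith [tendsto_nhds_unique tendsto_const_nhds h2]

theorem hasDerivAt_deriv_log_Gamma {x : ℝ} (hx : 1 < x) :
    HasDerivAt (deriv (log ∘ Gamma)) (∑' m : ℕ, 1 / (x + m) ^ 2) x := by
  have h : HasDerivAt (fun y : ℝ => ∑' m : ℕ, (1 / (1 + m : ℝ) - 1 / (y + m)))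
      (∑' m : ℕ, 1 / (x + m) ^ 2) x := by
    refine hasDerivAt_tsum_of_isPreconnected (t := Set.Ioi 1) (y₀ := 2)
      (g := fun (m : ℕ) (y : ℝ) => 1 / (1 + m : ℝ) - 1 / (y + m))
      (g' := fun (m : ℕ) (y : ℝ) => 1 / (y + m) ^ 2)
      summable_one_div_nat_add_one_sq isOpen_Ioi isPreconnected_Ioi (fun m y hy => ?_)
      (fun m y hy => ?_) (Set.mem_Ioi.2 one_lt_two) (summable_one_div_sub_one_div one_le_two) hx
    · have hy' : (1 : ℝ) < y := hy
      have hne : y + m ≠ 0 := by positivity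
      have := ((((hasDerivAt_id y).add_const (m : ℝ)).inv hne).const_sub (1 / (1 + m : ℝ)))
      simpa [neg_div] using this
    · have hy' : (1 : ℝ) < y := hy
      rw [norm_of_nonneg (by positivity)]
      gcongr 1 / ?_ ^ 2
      linarith
  refine (h.const_add (deriv (log ∘ Gamma) 1)).congr_of_eventuallyEq ?_
  filter_upwards [eventually_gt_nhds hx] with y hy
  exact deriv_log_Gamma_eq_tsum hy.le

end Real

namespace Complex

theorem digamma_ofReal {x : ℝ} (hx : 0 < x) :
    digamma (x : ℂ) = (deriv (Real.log ∘ Real.Gamma) x : ℝ) := by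
  have hne : ∀ m : ℕ, x ≠ -m := fun m => by
    have : (0 : ℝ) ≤ m := m.cast_nonneg
    linarith
  have h1 : HasDerivAt Gamma (deriv Gamma x) (x : ℂ) :=
    (differentiableAt_Gamma _ fun m => by exact_mod_cast hne m).hasDerivAt
  have h2 := (Real.differentiableAt_Gamma hne).hasDerivAt
  have h3 : HasDerivAt (fun y : ℝ => (Real.Gamma y : ℂ)) (deriv Gamma x) x := by
    simpa only [Gamma_ofReal] using h1.comp_ofReal
  have h4 : deriv Gamma (x : ℂ) = (deriv Real.Gamma x : ℝ) := h3.unique h2.ofReal_comp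
  have h5 : deriv (Real.log ∘ Real.Gamma) x = deriv Real.Gamma x / Real.Gamma x :=
    deriv.log (Real.differentiableAt_Gamma hne) (Real.Gamma_pos_of_pos hx).ne'
  rw [digamma_def, logDeriv_apply, h4, Gamma_ofReal, h5, ofReal_div]

theorem differentiableOn_Gamma_re_pos : DifferentiableOn ℂ Gamma {s | 0 < s.re} := by
  intro s hs
  refine (differentiableAt_Gamma _ fun m h => ?_).differentiableWithinAt
  rw [h] at hs
  simp at hs
  linarith [m.cast_nonneg (α := ℝ)]

theorem isOpen_re_pos : IsOpen {s : ℂ | 0 < s.re} := isOpen_lt continuous_const continuous_re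

theorem differentiableOn_digamma : DifferentiableOn ℂ digamma {s | 0 < s.re} :=
  (differentiableOn_Gamma_re_pos.deriv isOpen_re_pos).div differentiableOn_Gamma_re_pos
    fun _ hs => Gamma_ne_zero_of_re_pos hs

theorem deriv_digamma_ofReal {x : ℝ} (hx : 1 < x) :
    deriv digamma (x : ℂ) = ((∑' m : ℕ, 1 / (x + m) ^ 2 : ℝ) : ℂ) := by
  have hx0 : 0 < x := by linarith
  have h1 := (differentiableOn_digamma.differentiableAt
    (isOpen_re_pos.mem_nhds (show 0 < (x : ℂ).re from hx0))).hasDerivAt.comp_ofReal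
  refine h1.unique ((Real.hasDerivAt_deriv_log_Gamma hx).ofReal_comp.congr_of_eventuallyEq ?_)
  filter_upwards [eventually_gt_nhds hx0] with y hy
  exact digamma_ofReal hy

end Complex

/-! ### Mellin transforms of rational kernels and of the trigamma series. -/

-- The substitution x = t/(1+t) carries (0,∞) onto (0,1) and the Mellin integral to the Beta
-- integral.
open MeasureTheory in
theorem hasMellin_one_div_one_add_pow {w : ℂ} {n : ℕ} (hw : 0 < w.re) (hwn : w.re < n) :
    HasMellin (fun t : ℝ => 1 / (1 + (t : ℂ)) ^ n) w (Complex.betaIntegral w (n - w)) := by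
  set f : ℝ → ℝ := fun t => t / (1 + t) with hf
  set f' : ℝ → ℝ := fun t => 1 / (1 + t) ^ 2 with hf'
  set g : ℝ → ℂ := fun x => (x : ℂ) ^ (w - 1) * (1 - (x : ℂ)) ^ ((n - w) - 1) with hg
  have hder : ∀ t ∈ Set.Ioi (0 : ℝ), HasDerivWithinAt f (f' t) (Set.Ioi 0) t := by
    intro t ht
    have ht' : 0 < t := ht
    have hne : 1 + t ≠ 0 := by positivity
    have h := (hasDerivAt_id t).div ((hasDerivAt_id t).const_add 1) hne
    refine (h.congr_deriv ?_).hasDerivWithinAt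
    simp only [hf', id]
    congr 1
    ring
  have hinj : Set.InjOn f (Set.Ioi 0) := by
    intro t ht u hu h
    have ht' : 0 < t := ht
    have hu' : 0 < u := hu
    simp only [hf] at h
    rw [div_eq_div_iff (by positivity) (by positivity)] at h
    linarith
  have himg : f '' Set.Ioi 0 = Set.Ioo 0 1 := by
    ext x
    constructor
    · rintro ⟨t, ht, rfl⟩
      have ht' : 0 < t := ht
      refine ⟨by positivity, ?_⟩
      simp only [hf]
      rw [div_lt_one (by positivity)]
      linarith
    · rintro ⟨hx0, hx1⟩
      have h1 : 0 < 1 - x := by linarith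
      refine ⟨x / (1 - x), Set.mem_Ioi.2 (by positivity), ?_⟩
      simp only [hf]
      field_simp
      ring
  have hcongr : Set.EqOn (fun t => |f' t| • g (f t))
      (fun t : ℝ => (t : ℂ) ^ (w - 1) • (1 / (1 + (t : ℂ)) ^ n)) (Set.Ioi 0) := by
    intro t ht
    have ht' : 0 < t := ht
    have hp : 0 < 1 + t := by positivity
    have hpc : ((1 + t : ℝ) : ℂ) ≠ 0 := by exact_mod_cast hp.ne'
    have e1 : (1 - ((f t : ℝ) : ℂ)) = (((1 + t)⁻¹ : ℝ) : ℂ) := by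
      rw [← Complex.ofReal_one, ← Complex.ofReal_sub]
      congr 1
      simp only [hf]
      field_simp
      ring
    have e2 : ((f t : ℝ) : ℂ) ^ (w - 1) = (t : ℂ) ^ (w - 1) * ((1 + t : ℝ) : ℂ) ^ (-(w - 1)) := by
      simp only [hf, div_eq_mul_inv]
      rw [Complex.ofReal_mul, Complex.mul_cpow_ofReal_nonneg ht'.le (by positivity),
        Complex.ofReal_inv, Complex.inv_cpow _ _ ?_, Complex.cpow_neg]
      rw [Complex.arg_ofReal_of_nonneg hp.le]
      exact Real.pi_pos.ne
    have e3 : (((1 + t)⁻¹ : ℝ) : ℂ) ^ ((n - w) - 1) = ((1 + t : ℝ) : ℂ) ^ (-((n - w) - 1)) := by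
      rw [Complex.ofReal_inv, Complex.inv_cpow _ _ ?_, Complex.cpow_neg]
      rw [Complex.arg_ofReal_of_nonneg hp.le]
      exact Real.pi_pos.ne
    have e4 : |f' t| = ((1 + t) ^ 2)⁻¹ := by
      simp only [hf', one_div]
      exact abs_of_pos (by positivity)
    have e5 : ((1 + t : ℝ) : ℂ) ^ (-(w - 1)) * ((1 + t : ℝ) : ℂ) ^ (-((n - w) - 1)) =
        ((1 + t : ℝ) : ℂ) ^ 2 / ((1 + t : ℝ) : ℂ) ^ n := by
      rw [← Complex.cpow_add _ _ hpc, show -(w - 1) + -((n - w) - 1) = ((2 : ℕ) : ℂ) - (n : ℕ) by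
        push_cast; ring, Complex.cpow_sub _ _ hpc, Complex.cpow_natCast, Complex.cpow_natCast]
    simp only [hg]
    rw [e1, e2, e3, e4, mul_assoc, e5, Complex.real_smul, smul_eq_mul]
    have e6 : ((1 + t : ℝ) : ℂ) = 1 + (t : ℂ) := by push_cast; ring
    rw [e6] at hpc
    push_cast
    field_simp
  have hre : ((n : ℂ) - w).re = n - w.re := by simp
  have hconv := Complex.betaIntegral_convergent (u := w) (v := n - w) hw (by rw [hre]; linarith)
  rw [intervalIntegrable_iff_integrableOn_Ioo_of_le zero_le_one, ← himg] at hconv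
  constructor
  · rw [MellinConvergent, ← integrableOn_congr_fun hcongr measurableSet_Ioi]
    exact (integrableOn_image_iff_integrableOn_abs_deriv_smul measurableSet_Ioi hder hinj g).1 hconv
  · rw [mellin, ← setIntegral_congr_fun measurableSet_Ioi hcongr,
      ← integral_image_eq_integral_abs_deriv_smul measurableSet_Ioi hder hinj g, himg,
      Complex.betaIntegral, intervalIntegral.integral_of_le zero_le_one, integral_Ioc_eq_integral_Ioo]

theorem hasMellin_one_div_add_sq {w : ℂ} (hw : 0 < w.re) (hw2 : w.re < 2) {c : ℝ} (hc : 0 < c) :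
    HasMellin (fun t : ℝ => 1 / ((c : ℂ) + t) ^ 2) w
      ((c : ℂ) ^ (w - 2) * Complex.betaIntegral w (2 - w)) := by
  have h := hasMellin_one_div_one_add_pow (n := 2) hw (by exact_mod_cast hw2)
  have hcc : (c : ℂ) ≠ 0 := by exact_mod_cast hc.ne'
  have e : (fun t : ℝ => 1 / ((c : ℂ) + t) ^ 2) =
      fun t : ℝ => (1 / (c : ℂ) ^ 2) • (fun t : ℝ => 1 / (1 + (t : ℂ)) ^ 2) (c⁻¹ * t) := by
    funext t
    simp only [smul_eq_mul]
    rw [one_div_mul_one_div, ← mul_pow]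
    push_cast
    rw [mul_add, mul_inv_cancel_left₀ hcc, mul_one]
  have hconv : MellinConvergent (fun t : ℝ => (fun t : ℝ => 1 / (1 + (t : ℂ)) ^ 2) (c⁻¹ * t)) w :=
    (MellinConvergent.comp_mul_left (inv_pos.2 hc)).2 h.1
  rw [e]
  refine ⟨hconv.const_smul _, ?_⟩
  rw [mellin_const_smul,
    mellin_comp_mul_left (fun t : ℝ => 1 / (1 + (t : ℂ)) ^ 2) w (inv_pos.2 hc), h.2, smul_eq_mul, smul_eq_mul,
    Complex.ofReal_inv, Complex.inv_cpow _ _ ?_, Complex.cpow_neg, inv_inv,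
    Complex.cpow_sub _ _ hcc, Complex.cpow_ofNat]
  · push_cast; ring
  · rw [Complex.arg_ofReal_of_nonneg hc.le]
    exact Real.pi_pos.ne

open MeasureTheory in
theorem mellin_tsum_one_div_add_sq {w : ℂ} (hw : 0 < w.re) (hw1 : w.re < 1) :
    mellin (fun t : ℝ => ∑' m : ℕ, 1 / (((m + 1 : ℝ) : ℂ) + t) ^ 2) w =
      riemannZeta (2 - w) * Complex.betaIntegral w (2 - w) := by
  have hw2 : w.re < 2 := by linarith
  have hpos : ∀ m : ℕ, (0 : ℝ) < m + 1 := fun m => by positivity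
  -- The norm of the integrand is the same integrand at the real exponent Re w, so its integral is
  -- already known; Re w < 1 makes these values summable.
  have hnorm : ∀ m : ℕ, ∫ t in Set.Ioi (0 : ℝ),
      ‖(t : ℂ) ^ (w - 1) • (1 / (((m + 1 : ℝ) : ℂ) + t) ^ 2)‖ =
      ((m : ℝ) + 1) ^ (w.re - 2) * ‖Complex.betaIntegral w.re (2 - w.re)‖ := by
    intro m
    have h := (hasMellin_one_div_add_sq (w := (w.re : ℂ)) (by simpa using hw) (by simpa using hw2)
      (hpos m)).2
    rw [mellin] at h
    have hc : Set.EqOn (fun t : ℝ => (t : ℂ) ^ ((w.re : ℂ) - 1) • (1 / (((m + 1 : ℝ) : ℂ) + t) ^ 2))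
        (fun t : ℝ => ((‖(t : ℂ) ^ (w - 1) • (1 / (((m + 1 : ℝ) : ℂ) + t) ^ 2)‖ : ℝ) : ℂ))
        (Set.Ioi 0) := by
      intro t ht
      have ht' : 0 < t := ht
      have hp : (0 : ℝ) < (m + 1) + t := by have := hpos m; positivity
      simp only []
      rw [norm_smul, Complex.norm_cpow_eq_rpow_re_of_pos ht', ← Complex.ofReal_add, norm_div,
        norm_one, norm_pow, Complex.norm_real, Real.norm_of_nonneg hp.le]
      push_cast
      rw [Complex.ofReal_cpow ht'.le]
      simp
    rw [setIntegral_congr_fun measurableSet_Ioi hc, integral_complex_ofReal] at h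
    have h' := congrArg norm h
    rw [Complex.norm_real, Real.norm_of_nonneg (integral_nonneg fun t => norm_nonneg _), norm_mul,
      Complex.norm_cpow_eq_rpow_re_of_pos (hpos m)] at h'
    simpa using h'
  have hsum : HasSum (fun m : ℕ => ∫ t in Set.Ioi (0 : ℝ),
      (t : ℂ) ^ (w - 1) • (1 / (((m + 1 : ℝ) : ℂ) + t) ^ 2))
      (∫ t in Set.Ioi (0 : ℝ), ∑' m : ℕ, (t : ℂ) ^ (w - 1) • (1 / (((m + 1 : ℝ) : ℂ) + t) ^ 2)) := by
    refine hasSum_integral_of_summable_integral_norm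
      (fun m => (hasMellin_one_div_add_sq hw hw2 (hpos m)).1) ?_
    simp only [hnorm]
    refine Summable.mul_right _ ?_
    have h := (summable_nat_add_iff 1).2
      (Real.summable_nat_rpow.2 (show w.re - 2 < -1 by linarith))
    simpa using h
  rw [mellin]
  simp only [smul_eq_mul, ← tsum_mul_left] at hsum ⊢
  rw [← hsum.tsum_eq, zeta_eq_tsum_one_div_nat_add_one_cpow (by simp; linarith), ← tsum_mul_right]
  refine tsum_congr fun m => ?_
  have h := (hasMellin_one_div_add_sq hw hw2 (hpos m)).2
  rw [mellin] at h
  simp only [smul_eq_mul] at h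
  rw [h, one_div, ← Complex.cpow_neg, neg_sub]
  push_cast
  rfl

/-! ### Decay of the remainder. -/

theorem summable_one_div_add_nat_sq {v : ℝ} (hv : 1 ≤ v) :
    Summable fun m : ℕ => 1 / (v + m) ^ 2 := by
  refine Summable.of_nonneg_of_le (fun m => by positivity) (fun m => ?_)
    Real.summable_one_div_nat_add_one_sq
  gcongr 1 / ?_ ^ 2
  linarith

theorem tsum_one_div_add_nat_sq_le {v : ℝ} (hv : 1 ≤ v) :
    ∑' m : ℕ, 1 / (v + m) ^ 2 ≤ 1 / v + 1 / v ^ 2 := by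
  -- Telescoping majorant: 1/y + 1/y² drops by at least 1/y² from y to y + 1.
  have hstep : ∀ y : ℝ, 0 < y → 1 / y ^ 2 ≤ (1 / y + 1 / y ^ 2) -
      (1 / (y + 1) + 1 / (y + 1) ^ 2) := by
    intro y hy
    have : (1 / y + 1 / y ^ 2) - (1 / (y + 1) + 1 / (y + 1) ^ 2) - 1 / y ^ 2 =
        y / (y ^ 2 * (y + 1) ^ 2) := by
      field_simp
      ring
    have h2 : 0 ≤ y / (y ^ 2 * (y + 1) ^ 2) := by positivity
    linarith
  refine (summable_one_div_add_nat_sq hv).tsum_le_of_sum_range_le fun N => ?_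
  have h : ∑ m ∈ Finset.range N, 1 / (v + m) ^ 2 ≤
      (1 / v + 1 / v ^ 2) - (1 / (v + N) + 1 / (v + N) ^ 2) := by
    induction N with
    | zero => simp
    | succ N ih =>
      rw [Finset.sum_range_succ]
      have := hstep (v + N) (by positivity)
      push_cast
      rw [← add_assoc]
      linarith
  have h2 : 0 ≤ 1 / (v + N) + 1 / (v + N) ^ 2 := by positivity
  linarith

theorem le_tsum_one_div_add_nat_sq {v : ℝ} (hv : 1 ≤ v) :
    1 / v ≤ ∑' m : ℕ, 1 / (v + m) ^ 2 := by
  have hlim : Filter.Tendsto (fun N : ℕ => 1 / v - 1 / (v + N)) Filter.atTop (𝓝 (1 / v - 0)) := by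
    refine tendsto_const_nhds.sub (Filter.Tendsto.const_div_atTop ?_ 1)
    exact Filter.tendsto_atTop_add_const_left _ _ tendsto_natCast_atTop_atTop
  rw [sub_zero] at hlim
  refine le_of_tendsto_of_tendsto' hlim
    (summable_one_div_add_nat_sq hv).hasSum.tendsto_sum_nat fun N => ?_
  induction N with
  | zero => simp
  | succ N ih =>
    rw [Finset.sum_range_succ]
    have hy : 0 < v + N := by positivity
    have : 1 / (v + N) - 1 / (v + N + 1) ≤ 1 / (v + N) ^ 2 := by
      rw [div_sub_div _ _ hy.ne' (by positivity)]
      rw [div_le_div_iff₀ (by positivity) (by positivity)]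
      nlinarith
    push_cast
    rw [← add_assoc]
    linarith

/-- The function `u ↦ ψ'(1 + u) - 1 / (1 + u)`. -/
noncomputable def trigammaRemainder (u : ℝ) : ℂ :=
  deriv Complex.digamma (1 + (u : ℂ)) - 1 / (1 + (u : ℂ))

theorem deriv_digamma_one_add_ofReal {u : ℝ} (hu : 0 < u) :
    deriv Complex.digamma (1 + (u : ℂ)) = ((∑' m : ℕ, 1 / (1 + u + m) ^ 2 : ℝ) : ℂ) := by
  have := Complex.deriv_digamma_ofReal (x := 1 + u) (by linarith)
  rwa [Complex.ofReal_add, Complex.ofReal_one] at this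

/-- Subtracting 1/(1+u) leaves quadratic decay, which widens the strip from Re w < 1 to Re w < 2 and
so puts w = 1 in its interior. -/
theorem norm_trigammaRemainder_le {u : ℝ} (hu : 0 < u) :
    ‖trigammaRemainder u‖ ≤ 1 / (1 + u) ^ 2 := by
  have h1 := tsum_one_div_add_nat_sq_le (v := 1 + u) (by linarith)
  have h2 := le_tsum_one_div_add_nat_sq (v := 1 + u) (by linarith)
  have e : trigammaRemainder u = ((∑' m : ℕ, 1 / (1 + u + m) ^ 2 - 1 / (1 + u) : ℝ) : ℂ) := by
    rw [trigammaRemainder, deriv_digamma_one_add_ofReal hu]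
    push_cast
    rfl
  rw [e, Complex.norm_real, Real.norm_of_nonneg (by linarith)]
  linarith

theorem continuousOn_trigammaRemainder : ContinuousOn trigammaRemainder (Set.Ioi 0) := by
  have hmap : Set.MapsTo (fun u : ℝ => 1 + (u : ℂ)) (Set.Ioi 0) {s : ℂ | 0 < s.re} := by
    intro u hu
    have hu' : 0 < u := hu
    simp
    positivity
  have hc : ContinuousOn (fun u : ℝ => 1 + (u : ℂ)) (Set.Ioi 0) := by fun_prop
  refine ContinuousOn.sub ?_ ?_
  · exact (Complex.differentiableOn_digamma.deriv Complex.isOpen_re_pos).continuousOn.comp hc hmap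
  · refine continuousOn_const.div hc fun u hu h => ?_
    have := hmap hu
    simp only [Set.mem_ofPred_eq, h, Complex.zero_re, lt_irrefl] at this

/-! ### Differentiating Mellin transforms in a strip. -/

open MeasureTheory Filter Asymptotics in
/-- Regularity and growth that make the Mellin transform holomorphic on `b < re s < a` and that are
inherited by the product with the logarithm. -/
structure MellinStrip (b a : ℝ) (f : ℝ → ℂ) : Prop where
  locallyIntegrableOn : LocallyIntegrableOn f (Set.Ioi 0)
  isBigO_top : ∀ c < a, f =O[atTop] fun t : ℝ => t ^ (-c)
  isBigO_zero : ∀ c > b, f =O[𝓝[>] 0] fun t : ℝ => t ^ (-c)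

namespace MellinStrip

open MeasureTheory

variable {a b : ℝ} {f : ℝ → ℂ}

theorem log_smul (hf : MellinStrip b a f) : MellinStrip b a fun t => Real.log t • f t where
  locallyIntegrableOn := by
    refine hf.locallyIntegrableOn.continuousOn_smul isOpen_Ioi.isLocallyClosed ?_
    exact Real.continuousOn_log.mono fun t ht => (ne_of_gt ht : t ≠ 0)
  isBigO_top c hc := by
    -- The bounds hold for every exponent in an open range, so a slightly better exponent d absorbs
    -- the logarithm.
    obtain ⟨d, hcd, hda⟩ := exists_between hc
    exact isBigO_rpow_top_log_smul hcd (hf.isBigO_top d hda)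
  isBigO_zero c hc := by
    obtain ⟨d, hbd, hdc⟩ := exists_between hc
    exact isBigO_rpow_zero_log_smul hdc (hf.isBigO_zero d hbd)

theorem log_pow_smul (hf : MellinStrip b a f) (n : ℕ) :
    MellinStrip b a fun t => (Real.log t) ^ n • f t := by
  induction n with
  | zero => simpa using hf
  | succ n ih => simpa only [pow_succ', mul_smul] using ih.log_smul

theorem mellinConvergent (hf : MellinStrip b a f) {w : ℂ} (hb : b < w.re) (ha : w.re < a) :
    MellinConvergent f w := by
  obtain ⟨c, hc1, hc2⟩ := exists_between ha
  obtain ⟨d, hd1, hd2⟩ := exists_between hb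
  exact mellinConvergent_of_isBigO_rpow hf.locallyIntegrableOn (hf.isBigO_top c hc2) hc1
    (hf.isBigO_zero d hd1) hd2

theorem hasDerivAt_mellin (hf : MellinStrip b a f) {w : ℂ} (hb : b < w.re) (ha : w.re < a) :
    HasDerivAt (mellin f) (mellin (fun t => Real.log t • f t) w) w := by
  obtain ⟨c, hc1, hc2⟩ := exists_between ha
  obtain ⟨d, hd1, hd2⟩ := exists_between hb
  exact (mellin_hasDerivAt_of_isBigO_rpow hf.locallyIntegrableOn (hf.isBigO_top c hc2) hc1
    (hf.isBigO_zero d hd1) hd2).2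

theorem iteratedDeriv_mellin (hf : MellinStrip b a f) (n : ℕ) {w : ℂ} (hb : b < w.re)
    (ha : w.re < a) :
    iteratedDeriv n (mellin f) w = mellin (fun t => (Real.log t) ^ n • f t) w := by
  induction n generalizing w with
  | zero => simp
  | succ n ih =>
    rw [iteratedDeriv_succ]
    have h := (hf.log_pow_smul n).hasDerivAt_mellin hb ha
    simp only [← mul_smul, ← pow_succ'] at h
    rw [← h.deriv]
    refine Filter.EventuallyEq.deriv_eq ?_
    have ho : IsOpen {z : ℂ | b < z.re ∧ z.re < a} :=
      (isOpen_lt continuous_const Complex.continuous_re).inter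
        (isOpen_lt Complex.continuous_re continuous_const)
    filter_upwards [ho.mem_nhds ⟨hb, ha⟩] with z hz
    exact ih hz.1 hz.2

end MellinStrip

/-! ### The Mellin transform of the remainder. -/

open MeasureTheory Filter Asymptotics in
theorem mellinStrip_trigammaRemainder : MellinStrip 0 2 trigammaRemainder where
  locallyIntegrableOn := continuousOn_trigammaRemainder.locallyIntegrableOn measurableSet_Ioi
  isBigO_top c hc := by
    refine IsBigO.of_bound 1 ?_
    filter_upwards [eventually_ge_atTop 1] with u hu
    have hu0 : 0 < u := by linarith
    rw [Real.norm_of_nonneg (by positivity), one_mul]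
    refine (norm_trigammaRemainder_le hu0).trans ?_
    calc 1 / (1 + u) ^ 2 ≤ 1 / u ^ 2 := by gcongr; linarith
      _ = u ^ (-2 : ℝ) := by rw [Real.rpow_neg hu0.le, one_div]; norm_cast
      _ ≤ u ^ (-c) := Real.rpow_le_rpow_of_exponent_le hu (by linarith)
  isBigO_zero c hc := by
    refine IsBigO.of_bound 1 ?_
    filter_upwards [Ioo_mem_nhdsGT (zero_lt_one (α := ℝ))] with u hu
    have hu0 : 0 < u := hu.1
    rw [Real.norm_of_nonneg (by positivity), one_mul]
    refine (norm_trigammaRemainder_le hu0).trans ?_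
    calc 1 / (1 + u) ^ 2 ≤ 1 := by
          rw [div_le_one (by positivity)]; nlinarith
      _ ≤ u ^ (-c) := Real.one_le_rpow_of_pos_of_le_one_of_nonpos hu0 hu.2.le (by linarith)

/-- Here both pieces of the remainder have convergent transforms. Since Γ(2-w) = (1-w)Γ(1-w), the
term B(w,1-w) becomes the polar part 1/(1-w) of ζ(2-w). -/
theorem mellin_trigammaRemainder_of_re_lt_one {w : ℂ} (hw : 0 < w.re) (hw1 : w.re < 1) :
    mellin trigammaRemainder w =
      Complex.Gamma w * Complex.Gamma (2 - w) * zetaRegularPart (2 - w) := by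
  have hre1 : (1 - w).re = 1 - w.re := by simp
  have hre2 : (2 - w).re = 2 - w.re := by simp
  have h1 := hasMellin_one_div_one_add_pow (n := 1) hw (by exact_mod_cast hw1)
  have h2 := hasMellin_add (mellinStrip_trigammaRemainder.mellinConvergent hw (by linarith)) h1.1
  have h3 : mellin (fun t : ℝ => trigammaRemainder t + 1 / (1 + (t : ℂ)) ^ 1) w =
      riemannZeta (2 - w) * Complex.betaIntegral w (2 - w) := by
    rw [← mellin_tsum_one_div_add_sq hw hw1, mellin, mellin]
    refine MeasureTheory.setIntegral_congr_fun measurableSet_Ioi fun t ht => ?_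
    simp only [trigammaRemainder, pow_one, sub_add_cancel]
    rw [deriv_digamma_one_add_ofReal ht, Complex.ofReal_tsum]
    congr 1
    refine tsum_congr fun m => ?_
    push_cast
    congr 2
    ring
  have hne : 1 - w ≠ 0 := fun h => by rw [h] at hre1; simp at hre1; linarith
  have hz : zetaRegularPart (2 - w) = riemannZeta (2 - w) - 1 / (1 - w) := by
    rw [zetaRegularPart, Function.update_of_ne]
    · congr 2; ring
    · intro h; apply hne; linear_combination h
  have hG : Complex.Gamma (2 - w) = (1 - w) * Complex.Gamma (1 - w) := by
    rw [← Complex.Gamma_add_one _ hne]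
    congr 1
    ring
  have hB1 : Complex.betaIntegral w (1 - w) = Complex.Gamma w * Complex.Gamma (1 - w) := by
    rw [Complex.betaIntegral_eq_Gamma_mul_div _ _ hw (by linarith)]
    simp
  have hB2 : Complex.betaIntegral w (2 - w) = Complex.Gamma w * Complex.Gamma (2 - w) := by
    rw [Complex.betaIntegral_eq_Gamma_mul_div _ _ hw (by linarith)]
    simp
  have h4 := h2.2.symm.trans h3
  rw [h1.2, hB2, Nat.cast_one, hB1] at h4
  rw [eq_sub_of_add_eq h4, hz, hG]
  field_simp

/-- Both sides are analytic on the strip and agree near 1/2, so the identity theorem applies. -/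
theorem mellin_trigammaRemainder {w : ℂ} (hw : 0 < w.re) (hw2 : w.re < 2) :
    mellin trigammaRemainder w =
      Complex.Gamma w * Complex.Gamma (2 - w) * zetaRegularPart (2 - w) := by
  set U : Set ℂ := {z : ℂ | 0 < z.re ∧ z.re < 2} with hU
  have ho : IsOpen U := (isOpen_lt continuous_const Complex.continuous_re).inter
    (isOpen_lt Complex.continuous_re continuous_const)
  have hpre : IsPreconnected U := by
    have : Convex ℝ U := ((convex_Ioo (0 : ℝ) 2).linear_preimage Complex.reLm)
    exact this.isPreconnected
  have hf : AnalyticOnNhd ℂ (mellin trigammaRemainder) U :=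
    DifferentiableOn.analyticOnNhd (fun z hz => (mellinStrip_trigammaRemainder.hasDerivAt_mellin
      hz.1 hz.2).differentiableAt.differentiableWithinAt) ho
  have hg : AnalyticOnNhd ℂ (fun w => Complex.Gamma w * Complex.Gamma (2 - w) *
      zetaRegularPart (2 - w)) U := by
    refine DifferentiableOn.analyticOnNhd ?_ ho
    refine DifferentiableOn.mul (DifferentiableOn.mul ?_ ?_) ?_
    · exact Complex.differentiableOn_Gamma_re_pos.mono fun z hz => hz.1
    · refine Complex.differentiableOn_Gamma_re_pos.comp (by fun_prop) fun z hz => ?_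
      have := hz.2
      simp
      linarith
    · exact (differentiable_zetaRegularPart.comp (by fun_prop)).differentiableOn
  refine hf.eqOn_of_preconnected_of_eventuallyEq hg hpre (z₀ := 1 / 2)
    ⟨by norm_num, by norm_num⟩ ?_ ⟨hw, hw2⟩
  have ho1 : IsOpen {z : ℂ | 0 < z.re ∧ z.re < 1} :=
    (isOpen_lt continuous_const Complex.continuous_re).inter
      (isOpen_lt Complex.continuous_re continuous_const)
  filter_upwards [ho1.mem_nhds (x := 1 / 2) ⟨by norm_num, by norm_num⟩] with z hz
  exact mellin_trigammaRemainder_of_re_lt_one hz.1 hz.2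

/-! ### Taylor coefficients of πs/sin(πs). -/

theorem iteratedDeriv_eq_of_eventually_hasSum {f : ℂ → ℂ} {c : ℕ → ℂ} {z₀ : ℂ}
    (h : ∀ᶠ z in 𝓝 z₀, HasSum (fun n => c n * (z - z₀) ^ n) (f z)) (n : ℕ) :
    iteratedDeriv n f z₀ = (n ! : ℂ) * c n := by
  have h1 : HasFPowerSeriesAt f (FormalMultilinearSeries.ofScalars ℂ c) z₀ := by
    rw [hasFPowerSeriesAt_iff']
    filter_upwards [h] with z hz
    simpa [mul_comm] using hz
  have h2 := h1.eq_formalMultilinearSeries h1.analyticAt.hasFPowerSeriesAt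
  have h3 := congrArg (fun p => p.coeff n) h2
  simp only [FormalMultilinearSeries.coeff_ofScalars] at h3
  rw [h3, mul_div_cancel₀ _ (by exact_mod_cast n.factorial_ne_zero)]

theorem mem_integerComplement_of_norm_lt_one {s : ℂ} (h0 : s ≠ 0) (h1 : ‖s‖ < 1) :
    s ∈ Complex.integerComplement := by
  rintro ⟨n, rfl⟩
  rw [Complex.norm_intCast] at h1
  have hn : |n| < 1 := by exact_mod_cast h1
  exact h0 (by rw [Int.abs_lt_one_iff.1 hn]; simp)

theorem hasSum_riemannZeta_nat {k : ℕ} (hk : 1 < k) :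
    HasSum (fun m : ℕ => 1 / ((m : ℂ) + 1) ^ k) (riemannZeta (k : ℂ)) := by
  have hre : 1 < ((k : ℕ) : ℂ).re := by
    rw [Complex.natCast_re]
    exact_mod_cast hk
  have h := (summable_nat_add_iff 1).2 (Complex.summable_one_div_nat_cpow.2 hre)
  rw [zeta_eq_tsum_one_div_nat_add_one_cpow hre]
  simp only [Complex.cpow_natCast, Nat.cast_add, Nat.cast_one] at h ⊢
  exact h.hasSum

/-- The power series of the cotangent at its pole `0`. -/
theorem hasSum_zeta_mul_pow {s : ℂ} (h0 : s ≠ 0) (h1 : ‖s‖ < 1) :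
    HasSum (fun i : ℕ => (1 + (-1) ^ (i + 1)) * riemannZeta ((i + 1 : ℕ) : ℂ) * s ^ i)
      (1 / s - Real.pi * Complex.cot (Real.pi * s)) := by
  -- Expanding each pole pair of the cotangent series geometrically gives this double family:
  -- summing over i recovers the pole pair, summing over m a zeta value.
  set F : ℕ × ℕ → ℂ := fun q =>
    (1 + (-1) ^ (q.2 + 1)) * (1 / ((q.1 : ℂ) + 1) ^ (q.2 + 1)) * s ^ q.2 with hF
  have hsummable : Summable F := by
    have hs := (Real.summable_one_div_nat_add_one_sq).mul_of_nonneg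
      ((summable_geometric_of_lt_one (norm_nonneg s) h1).mul_left 2)
      (fun m => by positivity) (fun m => by positivity)
    refine Summable.of_norm_bounded hs fun q => ?_
    obtain ⟨m, i⟩ := q
    simp only [hF]
    rcases Nat.eq_zero_or_pos i with rfl | hi
    -- For i = 0 the factor 1 + (-1)^(i+1) vanishes, removing the divergent harmonic column; every
    -- other exponent i + 1 is at least 2.
    · simp
      positivity
    · rw [norm_mul, norm_mul, norm_pow]
      have e1 : ‖(1 + (-1 : ℂ) ^ (i + 1))‖ ≤ 2 := by
        refine (norm_add_le _ _).trans ?_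
        simp
        norm_num
      have e2 : ‖1 / ((m : ℂ) + 1) ^ (i + 1)‖ ≤ 1 / ((m : ℝ) + 1) ^ 2 := by
        have : ((m : ℂ) + 1) = ((m + 1 : ℝ) : ℂ) := by push_cast; rfl
        rw [this, norm_div, norm_one, norm_pow, Complex.norm_real,
          Real.norm_of_nonneg (by positivity)]
        have h1m : (1 : ℝ) ≤ m + 1 := by linarith [m.cast_nonneg (α := ℝ)]
        exact one_div_le_one_div_of_le (by positivity) (pow_le_pow_right₀ h1m (by omega))
      calc ‖(1 + (-1 : ℂ) ^ (i + 1))‖ * ‖1 / ((m : ℂ) + 1) ^ (i + 1)‖ * ‖s‖ ^ i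
          ≤ 2 * (1 / ((m : ℝ) + 1) ^ 2) * ‖s‖ ^ i := by gcongr
        _ = 1 / ((m : ℝ) + 1) ^ 2 * (2 * ‖s‖ ^ i) := by ring
  have hrow : ∀ m : ℕ, HasSum (fun i => F (m, i))
      (-(1 / (s - (m + 1)) + 1 / (s + (m + 1)))) := by
    intro m
    have hm : ((m : ℂ) + 1) ≠ 0 := Nat.cast_add_one_ne_zero m
    have hnm : ‖s / ((m : ℂ) + 1)‖ < 1 := by
      have : ((m : ℂ) + 1) = ((m + 1 : ℝ) : ℂ) := by push_cast; rfl
      rw [norm_div, this, Complex.norm_real, Real.norm_of_nonneg (by positivity),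
        div_lt_one (by positivity)]
      linarith [m.cast_nonneg (α := ℝ)]
    have hz := mem_integerComplement_of_norm_lt_one h0 h1
    have hd1 : s - ((m : ℂ) + 1) ≠ 0 := by
      simpa [sub_eq_add_neg] using Complex.integerComplement_add_ne_zero hz (-(m + 1) : ℤ)
    have hd2 : s + ((m : ℂ) + 1) ≠ 0 := by
      simpa using Complex.integerComplement_add_ne_zero hz ((m : ℤ) + 1)
    have hd3 : (m : ℂ) + 1 - s ≠ 0 := fun h => hd1 (by linear_combination -h)
    have hd4 : (m : ℂ) + 1 + s ≠ 0 := fun h => hd2 (by linear_combination h)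
    have g1 := (hasSum_geometric_of_norm_lt_one hnm).mul_left (1 / ((m : ℂ) + 1))
    have g2 := (hasSum_geometric_of_norm_lt_one (ξ := -(s / ((m : ℂ) + 1)))
      (by rwa [norm_neg])).mul_left (1 / ((m : ℂ) + 1))
    have g := g1.sub g2
    have ev : 1 / ((m : ℂ) + 1) * (1 - s / ((m : ℂ) + 1))⁻¹ -
        1 / ((m : ℂ) + 1) * (1 - -(s / ((m : ℂ) + 1)))⁻¹ =
        -(1 / (s - (m + 1)) + 1 / (s + (m + 1))) := by
      have i1 : 1 - s / ((m : ℂ) + 1) = (m + 1 - s) / (m + 1) := by field_simp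
      have i2 : 1 - -(s / ((m : ℂ) + 1)) = (m + 1 + s) / (m + 1) := by field_simp; ring
      rw [i1, i2, inv_div, inv_div, one_div_mul_eq_div, one_div_mul_eq_div,
        div_div_cancel_left' hm, div_div_cancel_left' hm, ← neg_sub (m + 1 : ℂ) s,
        add_comm s (m + 1 : ℂ), one_div, one_div, inv_neg]
      ring
    rw [ev] at g
    refine (congrArg (fun f => HasSum f _) (funext fun i => ?_)).mp g
    simp only [hF]
    rw [neg_pow (s / ((m : ℂ) + 1)) i, div_pow]
    field_simp
    ring
  have hcol : ∀ i : ℕ, HasSum (fun m => F (m, i))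
      ((1 + (-1) ^ (i + 1)) * riemannZeta ((i + 1 : ℕ) : ℂ) * s ^ i) := by
    intro i
    rcases Nat.eq_zero_or_pos i with rfl | hi
    -- The same vanishing factor makes the value assigned to ζ(1) irrelevant.
    · simp [hF]
    · simpa only [hF] using! ((hasSum_riemannZeta_nat (k := i + 1) (by omega)).mul_left
        (1 + (-1) ^ (i + 1))).mul_right (s ^ i)
  have htot := hsummable.hasSum.prod_fiberwise hrow
  have hcot := cot_series_rep' (mem_integerComplement_of_norm_lt_one h0 h1)
  have hval : ∑' q, F q = 1 / s - Real.pi * Complex.cot (Real.pi * s) := by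
    rw [← htot.tsum_eq, tsum_neg, ← hcot, neg_sub]
  rw [← hval]
  exact ((Equiv.prodComm ℕ ℕ).hasSum_iff.2 hsummable.hasSum).prod_fiberwise hcol

/-- The function `Γ(1 + s) Γ(1 - s) = π s / sin (π s)`. -/
noncomputable def gammaReflection (s : ℂ) : ℂ := Complex.Gamma (1 + s) * Complex.Gamma (1 - s)

theorem gammaReflection_zero : gammaReflection 0 = 1 := by simp [gammaReflection]

theorem gammaReflection_neg (s : ℂ) : gammaReflection (-s) = gammaReflection s := by
  rw [gammaReflection, gammaReflection, sub_neg_eq_add, ← sub_eq_add_neg, mul_comm]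

theorem one_add_re_pos {s : ℂ} (hs : ‖s‖ < 1) : 0 < (1 + s).re := by
  have := (abs_lt.1 ((Complex.abs_re_le_norm s).trans_lt hs)).1
  simp
  linarith

theorem one_sub_re_pos {s : ℂ} (hs : ‖s‖ < 1) : 0 < (1 - s).re := by
  simpa [sub_eq_add_neg] using one_add_re_pos (s := -s) (by rwa [norm_neg])

theorem gammaReflection_ne_zero {s : ℂ} (hs : ‖s‖ < 1) : gammaReflection s ≠ 0 :=
  mul_ne_zero (Complex.Gamma_ne_zero_of_re_pos (one_add_re_pos hs))
    (Complex.Gamma_ne_zero_of_re_pos (one_sub_re_pos hs))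

theorem analyticAt_gammaReflection : AnalyticAt ℂ gammaReflection 0 := by
  have h : AnalyticAt ℂ Complex.Gamma 1 :=
    Complex.differentiableOn_Gamma_re_pos.analyticAt
      (Complex.isOpen_re_pos.mem_nhds (by simp))
  refine AnalyticAt.mul ?_ ?_
  · exact AnalyticAt.fun_comp (by simpa using h) (by fun_prop)
  · exact AnalyticAt.fun_comp (by simpa using h) (by fun_prop)

theorem gammaReflection_eq {s : ℂ} (h0 : s ≠ 0) :
    gammaReflection s = (Complex.sin (Real.pi * s) / (Real.pi * s)) ^ (-1 : ℤ) := by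
  rw [gammaReflection, add_comm, Complex.Gamma_add_one _ h0, mul_assoc,
    Complex.Gamma_mul_Gamma_one_sub, zpow_neg_one, inv_div]
  ring

theorem logDeriv_gammaReflection {s : ℂ} (h0 : s ≠ 0) (h1 : ‖s‖ < 1) :
    logDeriv gammaReflection s = 1 / s - Real.pi * Complex.cot (Real.pi * s) := by
  have he : gammaReflection =ᶠ[𝓝 s]
      fun t => (Complex.sin (Real.pi * t) / (Real.pi * t)) ^ (-1 : ℤ) := by
    filter_upwards [isOpen_ne.mem_nhds h0] with t ht using gammaReflection_eq ht
  have hpi : (Real.pi : ℂ) ≠ 0 := by exact_mod_cast Real.pi_ne_zero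
  rw [(logDeriv_congr_nhds he).eq_of_nhds, logDeriv_fun_zpow,
    logDeriv_sin_div_eq_cot (mem_integerComplement_of_norm_lt_one h0 h1)]
  · push_cast; ring
  · refine DifferentiableAt.div (by fun_prop) (by fun_prop) (mul_ne_zero hpi h0)

/-- An even function has zero derivative at 0; the cotangent formula is unavailable there. -/
theorem logDeriv_gammaReflection_zero : logDeriv gammaReflection 0 = 0 := by
  have h := deriv_comp_neg gammaReflection 0
  simp only [gammaReflection_neg, neg_zero] at h
  rw [logDeriv_apply, self_eq_neg.1 h, zero_div]

theorem eventually_hasSum_logDeriv_gammaReflection :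
    ∀ᶠ s in 𝓝 (0 : ℂ), HasSum
      (fun i : ℕ => (1 + (-1) ^ (i + 1)) * riemannZeta ((i + 1 : ℕ) : ℂ) * (s - 0) ^ i)
      (logDeriv gammaReflection s) := by
  filter_upwards [Metric.ball_mem_nhds (0 : ℂ) one_pos] with s hs
  rw [mem_ball_zero_iff] at hs
  rw [sub_zero]
  by_cases h0 : s = 0
  · subst h0
    rw [logDeriv_gammaReflection_zero]
    convert! hasSum_zero with i
    rcases Nat.eq_zero_or_pos i with rfl | hi
    · simp
    · simp [hi.ne']
  · rw [logDeriv_gammaReflection h0 hs]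
    exact hasSum_zeta_mul_pow h0 hs

theorem iteratedDeriv_gammaReflection (n : ℕ) :
    iteratedDeriv n gammaReflection 0 =
      completeBell n (fun j : ℕ => (1 + (-1) ^ j) * ((j - 1)! : ℂ) * riemannZeta (j : ℂ)) := by
  have ha := analyticAt_gammaReflection
  have h0 : gammaReflection 0 ≠ 0 := by simp [gammaReflection_zero]
  refine iteratedDeriv_eq_completeBell (L := logDeriv gammaReflection) ha
    (ha.deriv.div ha h0) ?_ gammaReflection_zero (fun i => ?_) n
  · filter_upwards [Metric.ball_mem_nhds (0 : ℂ) one_pos] with s hs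
    rw [mem_ball_zero_iff] at hs
    rw [logDeriv_apply, div_mul_cancel₀ _ (gammaReflection_ne_zero hs)]
  -- The i-th derivative of L is i! times its i-th coefficient, which is the Bell argument of index
  -- i + 1; index 1 gives 0.
  · rw [iteratedDeriv_eq_of_eventually_hasSum eventually_hasSum_logDeriv_gammaReflection,
      Nat.add_sub_cancel]
    ring

/-! ### Leibniz rule at w = 1. -/

theorem mainTheorem6 (n : ℕ) :
    MeasureTheory.IntegrableOn
      (fun u : ℝ => (deriv Complex.digamma (1 + (u : ℂ)) - 1 / (1 + (u : ℂ))) *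
        (Real.log u : ℂ) ^ n) (Set.Ioi 0) ∧
    (∫ u in Set.Ioi (0 : ℝ), (deriv Complex.digamma (1 + (u : ℂ)) - 1 / (1 + (u : ℂ))) *
        (Real.log u : ℂ) ^ n) =
      ∑ k ∈ Finset.range (n + 1), (n.choose k : ℂ) *
        completeBell k (fun j : ℕ => (1 + (-1) ^ j) * ((j - 1)! : ℂ) * riemannZeta (j : ℂ)) *
        (-1) ^ k * stieltjesConstant (n - k) := by
  have hM := mellinStrip_trigammaRemainder
  have e : ∀ u : ℝ, (u : ℂ) ^ ((1 : ℂ) - 1) • ((Real.log u) ^ n • trigammaRemainder u) =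
      (deriv Complex.digamma (1 + (u : ℂ)) - 1 / (1 + (u : ℂ))) * (Real.log u : ℂ) ^ n := by
    intro u
    rw [sub_self, Complex.cpow_zero, one_smul, Complex.real_smul, Complex.ofReal_pow, mul_comm]
    rfl
  constructor
  · have h := (hM.log_pow_smul n).mellinConvergent (w := 1) (by simp) (by simp)
    simpa only [MellinConvergent, e] using h
  · have h := hM.iteratedDeriv_mellin n (w := 1) (by simp) (by simp)
    rw [mellin] at h
    simp only [e] at h
    rw [← h]
    have hshift : iteratedDeriv n (mellin trigammaRemainder) 1 =
        iteratedDeriv n (fun s => mellin trigammaRemainder (1 + s)) 0 := by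
      rw [iteratedDeriv_comp_const_add]
      simp only [add_zero]
    have hev : (fun s => mellin trigammaRemainder (1 + s)) =ᶠ[𝓝 0]
        fun s => gammaReflection s * zetaRegularPart (1 - s) := by
      filter_upwards [Metric.ball_mem_nhds (0 : ℂ) one_pos] with s hs
      rw [mem_ball_zero_iff] at hs
      have h2 := one_sub_re_pos hs
      rw [mellin_trigammaRemainder (one_add_re_pos hs) (by simp at h2 ⊢; linarith),
        gammaReflection]
      congr 2 <;> ring_nf
    have hZ : ContDiffAt ℂ n (fun s : ℂ => zetaRegularPart (1 - s)) 0 :=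
      (differentiable_zetaRegularPart.comp
        ((differentiable_const (1 : ℂ)).sub differentiable_id)).contDiff.contDiffAt
    rw [hshift, hev.iteratedDeriv_eq n,
      iteratedDeriv_fun_mul analyticAt_gammaReflection.contDiffAt hZ]
    refine Finset.sum_congr rfl fun k _ => ?_
    -- Evenness kills the odd derivatives, so the sign (-1)^k of the statement can be inserted
    -- freely. The sign from differentiating Z(1-s) goes into the Stieltjes constant.
    have hpar : iteratedDeriv k gammaReflection 0 =
        (-1) ^ k * iteratedDeriv k gammaReflection 0 := by
      have := iteratedDeriv_comp_neg k gammaReflection 0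
      simpa only [gammaReflection_neg, neg_zero, smul_eq_mul] using this
    rw [hpar, iteratedDeriv_gammaReflection, iteratedDeriv_comp_const_sub, stieltjesConstant]
    simp only [sub_zero, smul_eq_mul]
    ring
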